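/- Let $G$ be a finite simple graph. Write $\mathcal N(G)=\{x\in\mathbb R^{V(G)} : A(G)x=0\}$ for the null space of its adjacency matrix, $\mathrm{Supp}(G)=\{u\in V(G) : x_u\neq 0 \text{ for some } x\in\mathcal N(G)\}$, $\mathrm{Core}(G)=\bigcup_{u\in \mathrm{Supp}(G)}N(u)$, let $\mathcal F_S(G)$ be the subgraph of $G$ induced by the closed neighbourhood $N[\mathrm{Supp}(G)]$, and let $\mathcal F_N(G)=G-\mathcal F_S(G)$ be the graph obtained by deleting the vertices of $\mathcal F_S(G)$. Let $\nu(G)$ be the matching number of $G$, i.e. the number of edges of a maximum matching. A graph is unicyclic if it is connected and contains exactly one cycle. If $G$ is unicyclic with cycle $C$ and $v\in V(C)$, the pendant tree $G\{v\}$ of $G$ at $v$ is the connected induced subgraph of $G$ with the maximum possible number of vertices that contains $v$ and no other vertex of $C$; $G-G\{v\}$ is the graph obtained from $G$ by deleting the vertices of $G\{v\}$. The graph $G$ is of Type I if there is a vertex $w\in V(C)$ that is saturated by every maximum matching of $G\{w\}$. Theorem. Let $G$ be a finite unicyclic graph of Type I with cycle $C$, and let $v\in V(C)$ be such that $v\notin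 \mathrm{Supp}(G\{v\})$. Then $$\nu(G)=|\mathrm{Core}(G\{v\})|+|\mathrm{Core}(G-G\{v\})|+\frac{|V(\mathcal F_N(G\{v\}))|+|V(\mathcal F_N(G-G\{v\}))|}{2}.$$ -/

import Mathlib

namespace SimpleGraph

variable {V : Type*}

/-- `C` is (the subgraph formed by the vertices and edges of) a cycle of `G`. -/
def IsCycleSubgraph (G : SimpleGraph V) (C : G.Subgraph) : Prop :=
  ∃ (u : V) (p : G.Walk u u), p.IsCycle ∧ p.toSubgraph = C

/-- A unicyclic graph: connected, with exactly one cycle. -/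
def IsUnicyclic (G : SimpleGraph V) : Prop :=
  G.Connected ∧ ∃! C : G.Subgraph, G.IsCycleSubgraph C

/-- The set `H` induces a connected subgraph of `G` that contains `v` and no other vertex
of `C`. -/
structure IsPendantCandidate (G : SimpleGraph V) (C : G.Subgraph) (v : V) (H : Set V) : Prop where
  mem : v ∈ H
  eq_of_mem : ∀ w ∈ H, w ∈ C.verts → w = v
  connected : (G.induce H).Connected

/-- `H` is the vertex set of the pendant tree `G{v}` of `G` at the vertex `v` of the cycle `C`:
`G.induce H` has the maximum possible number of vertices among the connected induced subgraphs
that contain `v` and no other vertex of `C`. -/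
structure IsPendantTree (G : SimpleGraph V) (C : G.Subgraph) (v : V) (H : Set V) : Prop
    extends G.IsPendantCandidate C v H where
  ncard_le : ∀ H' : Set V, G.IsPendantCandidate C v H' → H'.ncard ≤ H.ncard

/-- `M` is a maximum matching of `G`. -/
def IsMaximumMatching (G : SimpleGraph V) (M : G.Subgraph) : Prop :=
  M.IsMatching ∧ ∀ M' : G.Subgraph, M'.IsMatching → M'.edgeSet.ncard ≤ M.edgeSet.ncard

/-- The matching number `ν(G)`: the largest number of edges in a matching (for finite `G`). -/
noncomputable def matchingNumber (G : SimpleGraph V) : ℕ :=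
  sSup {k | ∃ M : G.Subgraph, M.IsMatching ∧ M.edgeSet.ncard = k}

/-- `v` is matched in `G`: every maximum matching of `G` saturates `v`. The vertex of a one-vertex
graph is not matched, since the only matching there is the empty one. -/
def IsMatchedVertex (G : SimpleGraph V) (v : V) : Prop :=
  ∀ M : G.Subgraph, G.IsMaximumMatching M → v ∈ M.support

/-- A (unicyclic) graph is of Type I if some vertex `v` of its cycle is matched in the pendant
tree at `v`. -/
def IsTypeI (G : SimpleGraph V) : Prop :=
  ∃ (C : G.Subgraph) (v : V) (H : Set V) (hH : G.IsPendantTree C v H),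
    G.IsCycleSubgraph C ∧ v ∈ C.verts ∧ (G.induce H).IsMatchedVertex ⟨v, hH.mem⟩

section NullSpace

variable [Finite V]

open Classical in
/-- The null space of the adjacency matrix of a finite graph `G`. -/
noncomputable def nullSpace (G : SimpleGraph V) : Submodule ℝ (V → ℝ) :=
  letI : Fintype V := Fintype.ofFinite V
  LinearMap.ker (G.adjMatrix ℝ).mulVecLin

/-- `Supp(G)`: the vertices at which some vector of the null space is nonzero. -/
def nullSupp (G : SimpleGraph V) : Set V :=
  {v | ∃ x ∈ G.nullSpace, x v ≠ 0}

/-- `Core(G)`: the set of all neighbours of the vertices of `Supp(G)`. -/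
def nullCore (G : SimpleGraph V) : Set V :=
  ⋃ v ∈ G.nullSupp, G.neighborSet v

/-- The `S`-forest: the subgraph induced by the closed neighbourhood of `Supp(G)`. -/
def sForest (G : SimpleGraph V) : G.Subgraph :=
  (⊤ : G.Subgraph).induce (G.nullSupp ∪ ⋃ v ∈ G.nullSupp, G.neighborSet v)

/-- The `N`-forest: what remains of `G` after deleting the vertices of the `S`-forest. -/
def nForest (G : SimpleGraph V) : G.Subgraph :=
  (⊤ : G.Subgraph).deleteVerts G.sForest.verts

end NullSpace

end SimpleGraph

/-! The pendant tree `H` meets the rest of `G` only in edges at `v`, and since every cycle of `G` is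
`C`, both `G.induce H` and `G.induce Hᶜ` are forests.

For a forest, twice the matching number is `nullSize`, that is 2|Core| plus the order of the
N-forest (`IsAcyclic.isGreatest_nullSize`). Deleting a leaf `u` with its neighbour `w` lowers both
quantities by 2: support and core of the remainder do not change, and either `u` is in the support
and `w` in the core, or both belong to the N-forest (`IsLeafOn.nullSize_eq`). The same induction
shows that a vertex missed by some maximum matching lies in the support
(`IsAcyclic.mem_suppOn_of_card_eq`).

Hence `v ∉ Supp` forces every maximum matching of the tree to saturate `v`. If a matching of `G`
uses an edge leaving `H`, dropping that edge leaves `v` unmatched, so the part inside `H` is not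
maximum: the edge gained across the cut is lost in the tree. The matching number is therefore
additive over `H` and `Hᶜ` (`isGreatest_nullSize_add`).

Induced subgraphs are represented by a finset `S` of one fixed vertex type, and matchings by
involutions, so that deleting vertices never changes the type. -/

namespace SimpleGraph

/-! ### Null support and core of a forest under deletion of a pendant edge. -/

section Forest

open scoped Classical

variable {V : Type*} (F : SimpleGraph V) (S : Finset V)

/-- `x` lies in the kernel of the adjacency matrix of the subgraph of `F` induced by `S`
(only the values of `x` on `S` matter). -/
def IsNullOn (x : V → ℝ) : Prop := ∀ i ∈ S, ∑ j ∈ S with F.Adj i j, x j = 0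

/-- The null support of the subgraph of `F` induced by `S`. -/
noncomputable def suppOn : Finset V := {v ∈ S | ∃ x, F.IsNullOn S x ∧ x v ≠ 0}

/-- The core of the subgraph of `F` induced by `S`. -/
noncomputable def coreOn : Finset V := {w ∈ S | ∃ v ∈ F.suppOn S, F.Adj v w}

/-- The vertices of `S` outside of the null support and the core. -/
noncomputable def restOn : Finset V := {w ∈ S | w ∉ F.suppOn S ∧ w ∉ F.coreOn S}

/-- Twice the core plus the rest: for forests, twice the matching number. -/
noncomputable def nullSize : ℕ := 2 * (F.coreOn S).card + (F.restOn S).card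

/-- `f` is an involution whose moved points lie in `S` and are matched along edges of `F`. -/
structure IsMatchingMap (f : V → V) : Prop where
  invol : ∀ x, f (f x) = x
  adj : ∀ x, f x ≠ x → F.Adj x (f x)
  mem : ∀ x, f x ≠ x → x ∈ S

/-- The points moved by `f`. -/
noncomputable def movedPoints [Fintype V] (f : V → V) : Finset V := {x | f x ≠ x}

/-- `u` is a leaf of the subgraph of `F` induced by `S`, with neighbour `w`. -/
structure IsLeafOn (u w : V) : Prop where
  left_mem : u ∈ S
  right_mem : w ∈ S
  adj : F.Adj u w
  eq_of_adj : ∀ z ∈ S, F.Adj u z → z = w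

variable {F S}

@[simp] lemma mem_movedPoints [Fintype V] {f : V → V} {x : V} : x ∈ movedPoints f ↔ f x ≠ x := by
  simp [movedPoints]

lemma mem_suppOn {v : V} : v ∈ F.suppOn S ↔ v ∈ S ∧ ∃ x, F.IsNullOn S x ∧ x v ≠ 0 := by
  simp [suppOn]

lemma mem_coreOn {w : V} : w ∈ F.coreOn S ↔ w ∈ S ∧ ∃ v ∈ F.suppOn S, F.Adj v w := by
  simp [coreOn]

lemma mem_restOn {w : V} : w ∈ F.restOn S ↔ w ∈ S ∧ w ∉ F.suppOn S ∧ w ∉ F.coreOn S := by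
  simp [restOn]

/-- The start of a longest path is a leaf: a neighbour off the path would lengthen it, and a
neighbour on the path other than the second vertex would close a cycle. -/
lemma IsAcyclic.exists_isLeafOn (hF : F.IsAcyclic) {a b : V} (ha : a ∈ S) (hb : b ∈ S)
    (hab : F.Adj a b) : ∃ u w, F.IsLeafOn S u w := by
  classical
  set K := F.induce (S : Set V)
  have hK : K.IsAcyclic := hF.induce _
  have hadj : K.Adj ⟨a, ha⟩ ⟨b, hb⟩ := hab
  have : Nonempty (S : Set V) := ⟨⟨a, ha⟩⟩
  obtain ⟨u, v, p, hp, hmax⟩ := Walk.exists_isPath_forall_isPath_length_le_length K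
  have hlen : 1 ≤ p.length := hmax _ _ hadj.toWalk (Walk.IsPath.of_adj hadj)
  have hnil : ¬ p.Nil := by
    intro h; have := Walk.length_eq_zero_iff.2 h; omega
  refine ⟨u, p.snd, u.2, p.snd.2, p.adj_snd hnil, fun z hz huz => ?_⟩
  have hKz : K.Adj u ⟨z, hz⟩ := huz
  by_cases hmem : (⟨z, hz⟩ : (S : Set V)) ∈ p.support
  · have := hK.eq_snd_of_adj_start hp hKz hmem
    exact congrArg Subtype.val this
  · have := hmax _ _ (Walk.cons hKz.symm p) (hp.cons hmem)
    simp at this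

namespace IsLeafOn

variable {u w : V}

lemma ne (h : F.IsLeafOn S u w) : u ≠ w := h.adj.ne

lemma mem_erase_erase (h : F.IsLeafOn S u w) {z : V} :
    z ∈ S ↔ z = u ∨ z = w ∨ z ∈ (S.erase u).erase w := by
  have := h.left_mem
  have := h.right_mem
  by_cases z = u <;> by_cases z = w <;> simp_all

lemma sum_filter (h : F.IsLeafOn S u w) (p : V → Prop) (x : V → ℝ) :
    ∑ j ∈ S with p j, x j =
      (if p u then x u else 0) + ((if p w then x w else 0) +
        ∑ j ∈ (S.erase u).erase w with p j, x j) := by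
  rw [Finset.sum_filter, Finset.sum_filter, ← Finset.add_sum_erase S _ h.left_mem,
    ← Finset.add_sum_erase (S.erase u) _ (Finset.mem_erase.2 ⟨h.ne.symm, h.right_mem⟩)]

lemma not_adj_left (h : F.IsLeafOn S u w) {z : V} (hz : z ∈ (S.erase u).erase w) :
    ¬ F.Adj z u := by
  intro hzu
  simp only [Finset.mem_erase] at hz
  exact hz.1 (h.eq_of_adj z hz.2.2 hzu.symm)

/-- The equation at `u` says `x w = 0`, the equation at `w` determines `x u`, and once `x w = 0` the
others no longer see `u` or `w`. -/
lemma isNullOn_iff (h : F.IsLeafOn S u w) {x : V → ℝ} :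
    F.IsNullOn S x ↔ x w = 0 ∧ F.IsNullOn ((S.erase u).erase w) x ∧
      x u + ∑ j ∈ (S.erase u).erase w with F.Adj w j, x j = 0 := by
  have hu : ∑ j ∈ S with F.Adj u j, x j = x w := by
    have : ∑ j ∈ (S.erase u).erase w with F.Adj u j, x j = 0 := by
      refine Finset.sum_eq_zero fun j hj => ?_
      rw [Finset.mem_filter] at hj
      exact absurd hj.2.symm (h.not_adj_left hj.1)
    rw [h.sum_filter, this]
    simp [h.adj]
  have hw : ∑ j ∈ S with F.Adj w j, x j =
      x u + ∑ j ∈ (S.erase u).erase w with F.Adj w j, x j := by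
    rw [h.sum_filter]
    simp [h.adj.symm]
  have hi : ∀ i ∈ (S.erase u).erase w, x w = 0 → ∑ j ∈ S with F.Adj i j, x j =
      ∑ j ∈ (S.erase u).erase w with F.Adj i j, x j := by
    intro i hi h0
    rw [h.sum_filter]
    simp [h.not_adj_left hi, h0]
  constructor
  · intro hx
    have h0 : x w = 0 := hu ▸ hx u h.left_mem
    exact ⟨h0, fun i hiS => hi i hiS h0 ▸ hx i (h.mem_erase_erase.2 (.inr (.inr hiS))),
      hw ▸ hx w h.right_mem⟩
  · rintro ⟨h0, hx, hsum⟩ i hiS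
    rcases h.mem_erase_erase.1 hiS with rfl | rfl | hi'
    · rw [hu, h0]
    · rw [hw, hsum]
    · rw [hi i hi' h0, hx i hi']

/-- Null vectors extend over a pendant edge. -/
lemma exists_isNullOn (h : F.IsLeafOn S u w) {x : V → ℝ}
    (hx : F.IsNullOn ((S.erase u).erase w) x) :
    ∃ y, F.IsNullOn S y ∧ (∀ z ∈ (S.erase u).erase w, y z = x z) ∧
      y u = - ∑ j ∈ (S.erase u).erase w with F.Adj w j, x j := by
  set y : V → ℝ := fun z => if z = u then - ∑ j ∈ (S.erase u).erase w with F.Adj w j, x j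
    else if z = w then 0 else x z with hy
  have hyx : ∀ z ∈ (S.erase u).erase w, y z = x z := by
    intro z hz
    simp only [Finset.mem_erase] at hz
    simp [hy, hz.1, hz.2.1]
  have hsum : ∀ p : V → Prop, ∑ j ∈ (S.erase u).erase w with p j, y j =
      ∑ j ∈ (S.erase u).erase w with p j, x j := fun p =>
    Finset.sum_congr rfl fun j hj => hyx j (Finset.mem_of_mem_filter j hj)
  have hyu : y u = - ∑ j ∈ (S.erase u).erase w with F.Adj w j, x j := by simp [hy]
  refine ⟨y, h.isNullOn_iff.2 ⟨by simp [hy, h.ne.symm], fun i hi => ?_, ?_⟩, hyx, hyu⟩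
  · rw [hsum, hx i hi]
  · rw [hsum, hyu, neg_add_cancel]

lemma mem_suppOn_iff (h : F.IsLeafOn S u w) {z : V} (hz : z ∈ (S.erase u).erase w) :
    z ∈ F.suppOn S ↔ z ∈ F.suppOn ((S.erase u).erase w) := by
  rw [mem_suppOn, mem_suppOn]
  constructor
  · rintro ⟨-, x, hx, hxz⟩
    exact ⟨hz, x, (h.isNullOn_iff.1 hx).2.1, hxz⟩
  · rintro ⟨-, x, hx, hxz⟩
    obtain ⟨y, hy, hyx, -⟩ := h.exists_isNullOn hx
    exact ⟨h.mem_erase_erase.2 (.inr (.inr hz)), y, hy, by rwa [hyx z hz]⟩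

lemma right_notMem_suppOn (h : F.IsLeafOn S u w) : w ∉ F.suppOn S := by
  rw [mem_suppOn]
  rintro ⟨-, x, hx, hxw⟩
  exact hxw (h.isNullOn_iff.1 hx).1

end IsLeafOn

/-- In a forest, the neighbours of `w` lie in different components after deleting `w`, so a null
vector can be cut down to the component of one of them. -/
lemma IsAcyclic.exists_isNullOn_sum_ne_zero (hF : F.IsAcyclic) {w z : V} (hw : w ∉ S)
    (hz : z ∈ S) (hwz : F.Adj w z) {x : V → ℝ} (hx : F.IsNullOn S x) (hxz : x z ≠ 0) :
    ∃ y, F.IsNullOn S y ∧ ∑ j ∈ S with F.Adj w j, y j ≠ 0 := by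
  set K := F.deleteEdges {s(w, z)} with hK
  have hbr : ¬ K.Reachable w z := isBridge_iff.1 (isAcyclic_iff_forall_adj_isBridge.1 hF hwz)
  -- The witness is `x` cut down to the component of `z` once the edge `wz` is deleted. As `w ∉ S`,
  -- edges inside `S` survive and stay within one component; as `wz` is a bridge, `z` is the only
  -- neighbour of `w` left in the sum.
  refine ⟨fun j => if K.Reachable z j then x j else 0, fun i hi => ?_, ?_⟩
  · have hadj : ∀ j ∈ S, F.Adj i j → (K.Reachable z j ↔ K.Reachable z i) := by
      intro j hj hij
      have hij' : K.Adj i j := by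
        rw [hK, deleteEdges_adj]
        refine ⟨hij, fun he => ?_⟩
        rw [Set.mem_singleton_iff, Sym2.eq_iff] at he
        rcases he with ⟨rfl, -⟩ | ⟨-, rfl⟩ <;> exact hw ‹_›
      exact ⟨fun h => h.trans hij'.symm.reachable, fun h => h.trans hij'.reachable⟩
    by_cases hzi : K.Reachable z i
    · rw [← hx i hi]
      refine Finset.sum_congr rfl fun j hj => ?_
      rw [Finset.mem_filter] at hj
      exact if_pos ((hadj j hj.1 hj.2).2 hzi)
    · refine Finset.sum_eq_zero fun j hj => ?_
      rw [Finset.mem_filter] at hj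
      exact if_neg fun h => hzi ((hadj j hj.1 hj.2).1 h)
  · rw [Finset.sum_eq_single_of_mem z (by simp [hz, hwz])]
    · simpa using hxz
    · intro j hj hjz
      rw [Finset.mem_filter] at hj
      refine if_neg fun h => hbr (Reachable.symm (h.trans (Adj.reachable ?_)))
      rw [hK, deleteEdges_adj]
      refine ⟨hj.2.symm, fun he => ?_⟩
      rw [Set.mem_singleton_iff, Sym2.eq_iff] at he
      rcases he with ⟨rfl, -⟩ | ⟨h1, -⟩
      · exact hw hj.1
      · exact hjz h1

namespace IsLeafOn

variable {u w : V}

/-- The equation at `w` gives `x u` as minus the sum over the other neighbours of `w`. That sum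
could cancel for a given null vector; acyclicity supplies one for which it does not. -/
lemma left_mem_suppOn_iff (h : F.IsLeafOn S u w) (hF : F.IsAcyclic) :
    u ∈ F.suppOn S ↔ ∃ z ∈ F.suppOn ((S.erase u).erase w), F.Adj w z := by
  constructor
  · intro hu
    obtain ⟨-, x, hx, hxu⟩ := mem_suppOn.1 hu
    obtain ⟨-, hx', hsum⟩ := h.isNullOn_iff.1 hx
    have : ∑ j ∈ (S.erase u).erase w with F.Adj w j, x j ≠ 0 := by
      intro h0
      rw [h0, add_zero] at hsum
      exact hxu hsum
    obtain ⟨z, hz, hxz⟩ := Finset.exists_ne_zero_of_sum_ne_zero this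
    rw [Finset.mem_filter] at hz
    exact ⟨z, mem_suppOn.2 ⟨hz.1, x, hx', hxz⟩, hz.2⟩
  · rintro ⟨z, hz, hwz⟩
    obtain ⟨hzS, x, hx, hxz⟩ := mem_suppOn.1 hz
    obtain ⟨y, hy, hsum⟩ :=
      hF.exists_isNullOn_sum_ne_zero (Finset.notMem_erase w _) hzS hwz hx hxz
    obtain ⟨y', hy', -, hu⟩ := h.exists_isNullOn hy
    exact mem_suppOn.2 ⟨h.left_mem, y', hy', by rw [hu]; exact neg_ne_zero.2 hsum⟩

lemma mem_coreOn_iff (h : F.IsLeafOn S u w) {z : V} (hz : z ∈ (S.erase u).erase w) :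
    z ∈ F.coreOn S ↔ z ∈ F.coreOn ((S.erase u).erase w) := by
  rw [mem_coreOn, mem_coreOn]
  refine and_congr (by simp [h.mem_erase_erase.2 (.inr (.inr hz)), hz]) ⟨?_, ?_⟩
  · rintro ⟨v, hv, hvz⟩
    rcases h.mem_erase_erase.1 (mem_suppOn.1 hv).1 with rfl | rfl | hv'
    · exact absurd hvz.symm (h.not_adj_left hz)
    · exact absurd hv h.right_notMem_suppOn
    · exact ⟨v, (h.mem_suppOn_iff hv').1 hv, hvz⟩
  · rintro ⟨v, hv, hvz⟩
    exact ⟨v, (h.mem_suppOn_iff (mem_suppOn.1 hv).1).2 hv, hvz⟩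

lemma left_notMem_coreOn (h : F.IsLeafOn S u w) : u ∉ F.coreOn S := by
  rw [mem_coreOn]
  rintro ⟨-, v, hv, hvu⟩
  obtain rfl := h.eq_of_adj v (mem_suppOn.1 hv).1 hvu.symm
  exact h.right_notMem_suppOn hv

lemma right_mem_coreOn_iff (h : F.IsLeafOn S u w) (hF : F.IsAcyclic) :
    w ∈ F.coreOn S ↔ u ∈ F.suppOn S := by
  rw [mem_coreOn]
  refine ⟨?_, fun hu => ⟨h.right_mem, u, hu, h.adj⟩⟩
  rintro ⟨-, v, hv, hvw⟩
  rcases h.mem_erase_erase.1 (mem_suppOn.1 hv).1 with rfl | rfl | hv'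
  · exact hv
  · exact absurd hv h.right_notMem_suppOn
  · exact (h.left_mem_suppOn_iff hF).2 ⟨v, (h.mem_suppOn_iff hv').1 hv, hvw.symm⟩

lemma nullSize_eq (h : F.IsLeafOn S u w) (hF : F.IsAcyclic) :
    F.nullSize S = F.nullSize ((S.erase u).erase w) + 2 := by
  set T := (S.erase u).erase w with hT
  have hwT : w ∉ T := Finset.notMem_erase w _
  have huT : u ∉ T := fun hu => by simp [hT] at hu
  have hcT : ∀ z ∈ F.coreOn T, z ∈ T := fun z hz => (mem_coreOn.1 hz).1
  have hrT : ∀ z ∈ F.restOn T, z ∈ T := fun z hz => (mem_restOn.1 hz).1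
  have hcS : ∀ z ∈ F.coreOn S, z ∈ S := fun z hz => (mem_coreOn.1 hz).1
  have hmem := fun z => h.mem_erase_erase (z := z)
  have hrest : ∀ z ∈ T, (z ∈ F.restOn S ↔ z ∈ F.restOn T) := by
    intro z hz
    rw [mem_restOn, mem_restOn, h.mem_suppOn_iff hz, h.mem_coreOn_iff hz]
    simp only [(hmem z).2 (.inr (.inr hz)), hz, true_and]
    rfl
  have hrS : ∀ z ∈ F.restOn S, z ∈ S := fun z hz => (mem_restOn.1 hz).1
  have hucore := h.left_notMem_coreOn
  have hwcore := h.right_mem_coreOn_iff hF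
  -- If `u` is in the support, the core gains `w` and the rest is unchanged; otherwise the core is
  -- unchanged and the rest gains both `u` and `w`.
  by_cases hu : u ∈ F.suppOn S
  · have hc : F.coreOn S = insert w (F.coreOn T) := by
      ext z
      have := h.mem_coreOn_iff (z := z)
      grind
    have hr : F.restOn S = F.restOn T := by
      ext z
      have h1 : u ∉ F.restOn S := fun h' => (mem_restOn.1 h').2.1 hu
      have h2 : w ∉ F.restOn S := fun h' => (mem_restOn.1 h').2.2 (hwcore.2 hu)
      grind
    rw [nullSize, nullSize, hc, hr, Finset.card_insert_of_notMem fun h' => hwT (hcT _ h')]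
    ring
  · have hc : F.coreOn S = F.coreOn T := by
      ext z
      have := h.mem_coreOn_iff (z := z)
      grind
    have hr : F.restOn S = insert u (insert w (F.restOn T)) := by
      ext z
      have h1 : u ∈ F.restOn S := mem_restOn.2 ⟨h.left_mem, hu, hucore⟩
      have h2 : w ∈ F.restOn S :=
        mem_restOn.2 ⟨h.right_mem, h.right_notMem_suppOn, fun h' => hu (hwcore.1 h')⟩
      grind
    rw [nullSize, nullSize, hc, hr, Finset.card_insert_of_notMem, Finset.card_insert_of_notMem]
    · ring
    · exact fun h' => hwT (hrT _ h')
    · rw [Finset.mem_insert, not_or]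
      exact ⟨h.ne, fun h' => huT (hrT _ h')⟩

end IsLeafOn

lemma mem_suppOn_of_forall_not_adj (hS : ∀ a ∈ S, ∀ b ∈ S, ¬ F.Adj a b) {v : V} (hv : v ∈ S) :
    v ∈ F.suppOn S := by
  refine mem_suppOn.2 ⟨hv, fun _ => 1, fun i hi => Finset.sum_eq_zero fun j hj => ?_, one_ne_zero⟩
  rw [Finset.mem_filter] at hj
  exact absurd hj.2 (hS i hi j hj.1)

lemma nullSize_of_forall_not_adj (hS : ∀ a ∈ S, ∀ b ∈ S, ¬ F.Adj a b) : F.nullSize S = 0 := by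
  have hc : F.coreOn S = ∅ := Finset.eq_empty_of_forall_notMem fun w hw => by
    obtain ⟨hwS, v, hv, hvw⟩ := mem_coreOn.1 hw
    exact hS v (mem_suppOn.1 hv).1 w hwS hvw
  have hr : F.restOn S = ∅ := Finset.eq_empty_of_forall_notMem fun w hw => by
    obtain ⟨hwS, hws, -⟩ := mem_restOn.1 hw
    exact hws (mem_suppOn_of_forall_not_adj hS hwS)
  simp [nullSize, hc, hr]

end Forest

/-! ### Matchings as involutions, and maximum matchings of forests. -/

section MatchingMap

open scoped Classical

variable {V : Type*} {F : SimpleGraph V} {S : Finset V} {f : V → V}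

namespace IsMatchingMap

lemma restrict (hf : F.IsMatchingMap S f) {A : V → Prop} [DecidablePred A] (hA : ∀ x, A x → A (f x)) :
    F.IsMatchingMap {x ∈ S | A x} fun x => if A x then f x else x where
  invol x := by
    by_cases hx : A x <;> simp [hx, hA, hf.invol]
  adj x := by
    by_cases hx : A x
    · simpa [hx] using hf.adj x
    · simp [hx]
  mem x := by
    by_cases hx : A x
    · simpa [hx] using hf.mem x
    · simp [hx]

lemma mono {T : Finset V} (hf : F.IsMatchingMap S f) (hT : ∀ x, f x ≠ x → x ∈ T) :
    F.IsMatchingMap T f :=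
  ⟨hf.invol, hf.adj, hT⟩

lemma apply_ne (hf : F.IsMatchingMap S f) {x : V} (hx : f x ≠ x) : f (f x) ≠ f x := by
  rw [hf.invol]; exact hx.symm

lemma apply_mem (hf : F.IsMatchingMap S f) {x : V} (hx : f x ≠ x) : f x ∈ S :=
  hf.mem _ (hf.apply_ne hx)

/-- Drops the matching edge at `w`, if there is one, and keeps all others. -/
lemma exists_avoiding [Fintype V] (hf : F.IsMatchingMap S f) (w : V) :
    ∃ g, F.IsMatchingMap S g ∧ g w = w ∧ g (f w) = f w ∧ (∀ x, g x ≠ x → f x = g x) ∧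
      (movedPoints f).card ≤ (movedPoints g).card + 2 := by
  have hA : ∀ x, (x ≠ w ∧ x ≠ f w) → (f x ≠ w ∧ f x ≠ f w) := by
    rintro x ⟨h1, h2⟩
    exact ⟨fun h => h2 (by rw [← h, hf.invol]), fun h => h1 (by rw [← hf.invol x, h, hf.invol])⟩
  refine ⟨fun x => if x ≠ w ∧ x ≠ f w then f x else x, (hf.restrict hA).mono ?_, by simp, by simp,
    ?_, ?_⟩
  · intro x hx
    exact Finset.mem_of_mem_filter x ((hf.restrict hA).mem x hx)
  · intro x hx
    by_cases h : x ≠ w ∧ x ≠ f w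
    · exact (if_pos h).symm
    · exact absurd (if_neg h) hx
  · set g : V → V := fun x => if x ≠ w ∧ x ≠ f w then f x else x with hg
    have hsub : movedPoints f ⊆ insert w (insert (f w) (movedPoints g)) := by
      intro x hx
      rw [mem_movedPoints] at hx
      by_cases h1 : x = w
      · simp [h1]
      by_cases h2 : x = f w
      · simp [h2]
      · have : g x = f x := by simp [hg, h1, h2]
        simp [this, hx]
    have h1 := Finset.card_le_card hsub
    have h2 := Finset.card_insert_le w (insert (f w) (movedPoints g))
    have h3 := Finset.card_insert_le (f w) (movedPoints g)
    omega

lemma exists_insert [Fintype V] (hf : F.IsMatchingMap S f) {u w : V} (hu : u ∈ S) (hw : w ∈ S)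
    (huw : F.Adj u w) (hfu : f u = u) (hfw : f w = w) :
    ∃ g, F.IsMatchingMap S g ∧ (movedPoints g).card = (movedPoints f).card + 2 := by
  have hne := huw.ne
  have hfx : ∀ x, x ≠ u → x ≠ w → f x ≠ u ∧ f x ≠ w := by
    intro x h1 h2
    exact ⟨fun h => h1 (by rw [← hf.invol x, h, hfu]), fun h => h2 (by rw [← hf.invol x, h, hfw])⟩
  set g : V → V := fun x => if x = u then w else if x = w then u else f x with hg
  have hgu : g u = w := by simp [hg]
  have hgw : g w = u := by simp [hg, hne.symm]
  have hgx : ∀ x, x ≠ u → x ≠ w → g x = f x := fun x h1 h2 => by simp [hg, h1, h2]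
  refine ⟨g, ⟨fun x => ?_, fun x hx => ?_, fun x hx => ?_⟩, ?_⟩
  · by_cases h1 : x = u
    · rw [h1, hgu, hgw]
    by_cases h2 : x = w
    · rw [h2, hgw, hgu]
    rw [hgx x h1 h2, hgx _ (hfx x h1 h2).1 (hfx x h1 h2).2, hf.invol]
  · by_cases h1 : x = u
    · rw [h1, hgu]; exact huw
    by_cases h2 : x = w
    · rw [h2, hgw]; exact huw.symm
    rw [hgx x h1 h2] at hx ⊢
    exact hf.adj x hx
  · by_cases h1 : x = u
    · rwa [h1]
    by_cases h2 : x = w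
    · rwa [h2]
    rw [hgx x h1 h2] at hx
    exact hf.mem x hx
  · have : movedPoints g = insert u (insert w (movedPoints f)) := by
      ext x
      rw [Finset.mem_insert, Finset.mem_insert, mem_movedPoints, mem_movedPoints]
      by_cases h1 : x = u
      · simp [h1, hgu, hne.symm]
      by_cases h2 : x = w
      · simp [h2, hgw, hne]
      rw [hgx x h1 h2]
      simp [h1, h2]
    rw [this, Finset.card_insert_of_notMem, Finset.card_insert_of_notMem]
    · simp [hfw]
    · simp [hne, hfu]

/-- Removing a pendant edge from the ground set costs at most two matched vertices. -/
lemma exists_erase_erase [Fintype V] (hf : F.IsMatchingMap S f) {u w : V}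
    (h : F.IsLeafOn S u w) :
    ∃ g, F.IsMatchingMap ((S.erase u).erase w) g ∧ g (f w) = f w ∧ (∀ x, g x ≠ x → f x = g x) ∧
      (movedPoints f).card ≤ (movedPoints g).card + 2 := by
  obtain ⟨g, hg, hgw, hgfw, hgf, hcard⟩ := hf.exists_avoiding w
  refine ⟨g, hg.mono fun x hx => ?_, hgfw, hgf, hcard⟩
  rw [Finset.mem_erase, Finset.mem_erase]
  refine ⟨by rintro rfl; exact hx hgw, ?_, hg.mem x hx⟩
  rintro rfl
  -- With `w` freed, the leaf cannot be matched either, since `w` is its only possible partner.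
  have : g x = w := h.eq_of_adj _ (hg.apply_mem hx) (hg.adj x hx)
  exact h.ne (by rw [← hg.invol x, this, hgw])

end IsMatchingMap

/-- In a forest, the largest number of matched vertices is `nullSize`. -/
lemma IsAcyclic.isGreatest_nullSize [Fintype V] (hF : F.IsAcyclic) (S : Finset V) :
    IsGreatest {k | ∃ f, F.IsMatchingMap S f ∧ (movedPoints f).card = k} (F.nullSize S) := by
  induction S using Finset.strongInduction with
  | H S ih =>
    by_cases hS : ∀ a ∈ S, ∀ b ∈ S, ¬ F.Adj a b
    · rw [nullSize_of_forall_not_adj hS]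
      refine ⟨⟨id, ⟨fun _ => rfl, fun x hx => absurd rfl hx, fun x hx => absurd rfl hx⟩, ?_⟩, ?_⟩
      · simp [movedPoints]
      · rintro k ⟨f, hf, rfl⟩
        rw [Nat.le_zero, Finset.card_eq_zero]
        refine Finset.eq_empty_of_forall_notMem fun x hx => ?_
        rw [mem_movedPoints] at hx
        exact hS x (hf.mem x hx) (f x) (hf.apply_mem hx) (hf.adj x hx)
    · push Not at hS
      obtain ⟨a, ha, b, hb, hab⟩ := hS
      obtain ⟨u, w, h⟩ := hF.exists_isLeafOn ha hb hab
      have hsub : (S.erase u).erase w ⊂ S :=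
        lt_of_le_of_lt (Finset.erase_subset _ _) (Finset.erase_ssubset h.left_mem)
      obtain ⟨⟨f, hf, hcard⟩, hub⟩ := ih _ hsub
      rw [h.nullSize_eq hF]
      constructor
      · have hu : f u = u := by
          by_contra hu
          simpa using hf.mem u hu
        have hw : f w = w := by
          by_contra hw
          simpa using hf.mem w hw
        obtain ⟨g, hg, hgc⟩ := (hf.mono fun x hx => hsub.1 (hf.mem x hx)).exists_insert
          h.left_mem h.right_mem h.adj hu hw
        exact ⟨g, hg, by rw [hgc, hcard]⟩
      · rintro k ⟨f, hf, rfl⟩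
        obtain ⟨g, hg, -, -, hc⟩ := hf.exists_erase_erase h
        exact hc.trans (Nat.add_le_add_right (hub ⟨g, hg, rfl⟩) 2)

/-- In a forest, a vertex missed by a maximum matching lies in the null support. -/
lemma IsAcyclic.mem_suppOn_of_card_eq [Fintype V] (hF : F.IsAcyclic) 
    (hf : F.IsMatchingMap S f) (hcard : (movedPoints f).card = F.nullSize S) {v : V}
    (hv : v ∈ S) (hfv : f v = v) : v ∈ F.suppOn S := by
  induction S using Finset.strongInduction generalizing f v with
  | H S ih =>
    by_cases hS : ∀ a ∈ S, ∀ b ∈ S, ¬ F.Adj a b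
    · exact mem_suppOn_of_forall_not_adj hS hv
    push Not at hS
    obtain ⟨a, ha, b, hb, hab⟩ := hS
    obtain ⟨u, w, h⟩ := hF.exists_isLeafOn ha hb hab
    have hsub : (S.erase u).erase w ⊂ S :=
      lt_of_le_of_lt (Finset.erase_subset _ _) (Finset.erase_ssubset h.left_mem)
    obtain ⟨g, hg, hgfw, hgf, hc⟩ := hf.exists_erase_erase h
    -- `g` loses at most two matched vertices and `nullSize` drops by exactly two, so `g` is again
    -- maximum.
    have hgcard : (movedPoints g).card = F.nullSize ((S.erase u).erase w) := by
      have h1 := (hF.isGreatest_nullSize _).2 ⟨g, hg, rfl⟩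
      have h2 := h.nullSize_eq hF
      omega
    have hfix : ∀ x, f x = x → g x = x := fun x hx => by
      by_contra hgx
      exact hgx ((hgf x hgx).symm.trans hx)
    -- Otherwise the leaf `u` is unmatched too, and adding the edge `uw` contradicts maximality.
    have hfw : f w ≠ w := by
      intro hfw
      have hfu : f u = u := by
        by_contra hu
        have : f u = w := h.eq_of_adj _ (hf.apply_mem hu) (hf.adj u hu)
        exact h.ne (by rw [← hf.invol u, this, hfw])
      obtain ⟨k, hk, hkc⟩ := hf.exists_insert h.left_mem h.right_mem h.adj hfu hfw
      have := (hF.isGreatest_nullSize S).2 ⟨k, hk, rfl⟩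
      omega
    rcases h.mem_erase_erase.1 hv with rfl | rfl | hv'
    -- When the missed vertex is the leaf itself, the partner of `w` is missed by `g`, so by
    -- induction it is a support neighbour of `w`, which puts the leaf in the support.
    · have hz : f w ∈ (S.erase v).erase w := by
        rw [Finset.mem_erase, Finset.mem_erase]
        refine ⟨hfw, fun hfwv => ?_, hf.apply_mem hfw⟩
        rw [← hfwv, hf.invol] at hfv
        exact hfw hfv.symm
      exact (h.left_mem_suppOn_iff hF).2 ⟨f w, ih _ hsub hg hgcard hz hgfw, hf.adj w hfw⟩
    · exact absurd hfv hfw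
    · exact (h.mem_suppOn_iff hv').2 (ih _ hsub hg hgcard hv' (hfix v hfv))

/-- Handshake lemma: the degrees are 1 on the matched vertices and 0 elsewhere. -/
lemma Subgraph.IsMatching.ncard_verts [Fintype V] {M : F.Subgraph} (hM : M.IsMatching) :
    M.verts.ncard = 2 * M.edgeSet.ncard := by
  have h := M.spanningCoe.sum_degrees_eq_twice_card_edges
  have hdeg : ∀ x, M.spanningCoe.degree x = if x ∈ M.verts then 1 else 0 := by
    intro x
    by_cases hx : x ∈ M.verts
    · rw [if_pos hx, SimpleGraph.degree_eq_one_iff_existsUnique_adj]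
      exact hM hx
    · rw [if_neg hx, SimpleGraph.degree_eq_zero]
      intro y hy
      exact hx (M.edge_vert hy)
  simp only [hdeg] at h
  rw [Finset.sum_boole, Nat.cast_id] at h
  have h1 : M.verts.ncard = (Finset.univ.filter (· ∈ M.verts)).card := by
    rw [← Set.ncard_coe_finset]; simp
  have h2 : M.edgeSet.ncard = M.spanningCoe.edgeFinset.card := by
    rw [← Set.ncard_coe_finset]; simp
  rw [h1, h2, h]

/-- The subgraph formed by the edges of a matching given as an involution. -/
def IsMatchingMap.toSubgraph (hf : F.IsMatchingMap S f) : F.Subgraph where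
  verts := {x | f x ≠ x}
  Adj x y := f x ≠ x ∧ f x = y
  adj_sub := by
    rintro x y ⟨hx, rfl⟩
    exact hf.adj x hx
  edge_vert h := h.1
  symm := ⟨by
    rintro x y ⟨hx, rfl⟩
    exact ⟨hf.apply_ne hx, hf.invol x⟩⟩

lemma IsMatchingMap.isMatching_toSubgraph (hf : F.IsMatchingMap S f) :
    hf.toSubgraph.IsMatching :=
  fun x hx => ⟨f x, ⟨hx, rfl⟩, fun _ hy => hy.2.symm⟩

lemma IsMatchingMap.card_movedPoints [Fintype V] (hf : F.IsMatchingMap S f) :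
    (movedPoints f).card = 2 * hf.toSubgraph.edgeSet.ncard := by
  rw [← hf.isMatching_toSubgraph.ncard_verts, ← Set.ncard_coe_finset]
  congr 1
  ext x
  simp [toSubgraph]

lemma Subgraph.IsMatching.exists_isMatchingMap [Fintype V] {M : F.Subgraph} (hM : M.IsMatching) :
    ∃ f, F.IsMatchingMap Finset.univ f ∧ (movedPoints f).card = 2 * M.edgeSet.ncard := by
  choose! f hf hf' using fun x (hx : x ∈ M.verts) => hM hx
  set g : V → V := fun x => if x ∈ M.verts then f x else x with hg
  have hgM : ∀ x ∈ M.verts, g x = f x := fun x hx => if_pos hx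
  have hgM' : ∀ x ∉ M.verts, g x = x := fun x hx => if_neg hx
  have hne : ∀ x, g x ≠ x ↔ x ∈ M.verts := by
    intro x
    by_cases hx : x ∈ M.verts
    · simp only [hgM x hx, hx, iff_true]
      exact (hf x hx).ne.symm
    · simp [hgM' x hx, hx]
  refine ⟨g, ⟨fun x => ?_, fun x hx => ?_, fun x _ => Finset.mem_univ x⟩, ?_⟩
  · by_cases hx : x ∈ M.verts
    · have hfx : f x ∈ M.verts := M.edge_vert (hf x hx).symm
      rw [hgM x hx, hgM _ hfx]
      exact (hf' _ hfx x (hf x hx).symm).symm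
    · rw [hgM' x hx, hgM' x hx]
  · have hx' := (hne x).1 hx
    rw [hgM x hx']
    exact M.adj_sub (hf x hx')
  · rw [← hM.ncard_verts, ← Set.ncard_coe_finset]
    congr 1
    ext x
    simpa using hne x

/-- The matching number in terms of involutions. -/
lemma two_mul_matchingNumber_of_isGreatest [Fintype V] {G : SimpleGraph V} {n : ℕ}
    (hn : IsGreatest {k | ∃ f, G.IsMatchingMap Finset.univ f ∧ (movedPoints f).card = k} n) :
    2 * G.matchingNumber = n := by
  obtain ⟨⟨f, hf, rfl⟩, hub⟩ := hn
  rw [hf.card_movedPoints] at hub ⊢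
  congr 1
  refine IsGreatest.csSup_eq ⟨⟨_, hf.isMatching_toSubgraph, rfl⟩, ?_⟩
  rintro k ⟨M, hM, rfl⟩
  obtain ⟨g, hg, hgc⟩ := hM.exists_isMatchingMap
  have := hub ⟨g, hg, rfl⟩
  omega

end MatchingMap

/-! ### From induced subgraphs on subtypes to the fixed vertex type; additivity across a cut. -/

section Transfer

open scoped Classical

variable {V : Type*}

lemma mem_nullSpace_iff [Fintype V] {G : SimpleGraph V} {x : V → ℝ} :
    x ∈ G.nullSpace ↔ ∀ i, ∑ j with G.Adj i j, x j = 0 := by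
  have h : x ∈ LinearMap.ker (G.adjMatrix ℝ).mulVecLin ↔
      ∀ i, ∑ j with G.Adj i j, x j = 0 := by
    rw [LinearMap.mem_ker, funext_iff]
    refine forall_congr' fun i => ?_
    rw [Matrix.mulVecLin_apply, adjMatrix_mulVec_apply, Pi.zero_apply,
      neighborFinset_eq_filter]
  rw [← h, nullSpace]
  -- Only the choice of `Fintype` instance inside `nullSpace` differs.
  convert Iff.rfl
  rfl

variable {G : SimpleGraph V} {H : Set V}

lemma spanningCoe_induce_adj_iff {a b : V} :
    (G.induce H).spanningCoe.Adj a b ↔ a ∈ H ∧ b ∈ H ∧ G.Adj a b := by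
  rw [spanningCoe, map_adj]
  constructor
  · rintro ⟨a, b, h, rfl, rfl⟩
    exact ⟨a.2, b.2, h⟩
  · rintro ⟨ha, hb, h⟩
    exact ⟨⟨a, ha⟩, ⟨b, hb⟩, h, rfl, rfl⟩

lemma sum_induce [Fintype V] (p : V → Prop) (x : V → ℝ) :
    ∑ j ∈ Finset.univ.filter (fun j : H => p j), x j = ∑ j ∈ H.toFinite.toFinset with p j, x j := by
  rw [Finset.sum_filter, Finset.sum_filter,
    Finset.sum_subtype H.toFinite.toFinset (p := (· ∈ H)) (fun _ => Set.Finite.mem_toFinset _)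
      (fun j => if p j then x j else 0)]

lemma mem_nullSpace_induce_iff [Finite V] {x : V → ℝ} :
    (fun j : H => x j) ∈ (G.induce H).nullSpace ↔
      (G.induce H).spanningCoe.IsNullOn H.toFinite.toFinset x := by
  have := Fintype.ofFinite V
  rw [mem_nullSpace_iff, IsNullOn, Subtype.forall]
  refine forall_congr' fun i => ?_
  rw [Set.Finite.mem_toFinset]
  refine forall_congr' fun hi => ?_
  rw [← sum_induce]
  refine Eq.congr (Finset.sum_congr ?_ fun _ _ => rfl) rfl
  ext j
  simp [hi]

lemma mem_nullSupp_induce_iff [Finite V] {v : H} :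
    v ∈ (G.induce H).nullSupp ↔ (v : V) ∈ (G.induce H).spanningCoe.suppOn H.toFinite.toFinset := by
  rw [mem_suppOn, nullSupp, Set.mem_ofPred_eq]
  constructor
  · rintro ⟨x, hx, hxv⟩
    refine ⟨by simp, fun j => if hj : j ∈ H then x ⟨j, hj⟩ else 0,
      mem_nullSpace_induce_iff.1 (by simpa using hx), by simpa using hxv⟩
  · rintro ⟨-, x, hx, hxv⟩
    exact ⟨_, mem_nullSpace_induce_iff.2 hx, hxv⟩

lemma mem_nullCore_induce_iff [Finite V] {w : H} :
    w ∈ (G.induce H).nullCore ↔ (w : V) ∈ (G.induce H).spanningCoe.coreOn H.toFinite.toFinset := by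
  simp only [mem_coreOn, nullCore, Set.mem_iUnion, exists_prop, mem_neighborSet,
    Set.Finite.mem_toFinset, spanningCoe_induce_adj_iff, mem_nullSupp_induce_iff, w.2, true_and]
  constructor
  · rintro ⟨v, hv, hvw⟩
    exact ⟨v, hv, v.2, hvw⟩
  · rintro ⟨v, hv, hvH, hvw⟩
    exact ⟨⟨v, hvH⟩, hv, hvw⟩

lemma mem_nForest_induce_iff [Finite V] {w : H} :
    w ∈ (G.induce H).nForest.verts ↔
      (w : V) ∈ (G.induce H).spanningCoe.restOn H.toFinite.toFinset := by
  rw [mem_restOn, ← mem_nullSupp_induce_iff, ← mem_nullCore_induce_iff]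
  simp [nForest, sForest, nullCore]

lemma ncard_eq_card_of_mem_iff {A : Set H} {B : Finset V} (hB : ∀ x ∈ B, x ∈ H)
    (h : ∀ x : H, x ∈ A ↔ (x : V) ∈ B) : A.ncard = B.card := by
  rw [← Set.ncard_coe_finset, ← Set.ncard_image_of_injective A Subtype.val_injective]
  congr 1
  ext x
  simp only [Set.mem_image, h, Subtype.exists, Finset.mem_coe]
  exact ⟨by rintro ⟨_, _, hx, rfl⟩; exact hx, fun hx => ⟨x, hB x hx, hx, rfl⟩⟩

lemma nullSize_spanningCoe_induce [Finite V] :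
    (G.induce H).spanningCoe.nullSize H.toFinite.toFinset =
      2 * (G.induce H).nullCore.ncard + (G.induce H).nForest.verts.ncard := by
  have hc := ncard_eq_card_of_mem_iff
    (fun x hx => (Set.Finite.mem_toFinset _).1 (mem_coreOn.1 hx).1)
    fun w => mem_nullCore_induce_iff (G := G) (H := H) (w := w)
  have hr := ncard_eq_card_of_mem_iff
    (fun x hx => (Set.Finite.mem_toFinset _).1 (mem_restOn.1 hx).1)
    fun w => mem_nForest_induce_iff (G := G) (H := H) (w := w)
  rw [nullSize, hc, hr]

lemma IsMatchingMap.toInduce [Finite V] {f : V → V} (hf : G.IsMatchingMap H.toFinite.toFinset f) :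
    (G.induce H).spanningCoe.IsMatchingMap H.toFinite.toFinset f := by
  refine ⟨hf.invol, fun x hx => ?_, hf.mem⟩
  exact spanningCoe_induce_adj_iff.2 ⟨(Set.Finite.mem_toFinset _).1 (hf.mem x hx),
    (Set.Finite.mem_toFinset _).1 (hf.apply_mem hx), hf.adj x hx⟩

lemma IsMatchingMap.card_eq_add [Fintype V] {f : V → V} (hf : G.IsMatchingMap Finset.univ f)
    (hH : ∀ x ∈ H, f x ∈ H) :
    ∃ g k, (G.induce H).spanningCoe.IsMatchingMap H.toFinite.toFinset g ∧
      (G.induce Hᶜ).spanningCoe.IsMatchingMap (Hᶜ).toFinite.toFinset k ∧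
      (∀ x ∈ H, g x = f x) ∧
      (movedPoints f).card = (movedPoints g).card + (movedPoints k).card := by
  have hH' : ∀ x ∈ Hᶜ, f x ∈ Hᶜ := fun x hx h => hx (by rw [← hf.invol x]; exact hH _ h)
  have hg := hf.restrict (A := (· ∈ H)) hH
  have hk := hf.restrict (A := (· ∈ Hᶜ)) hH'
  refine ⟨_, _, (hg.mono fun x hx => ?_).toInduce, (hk.mono fun x hx => ?_).toInduce,
    fun x hx => if_pos hx, ?_⟩
  · simpa using hg.mem x hx
  · simpa using hk.mem x hx
  · rw [← Finset.card_union_of_disjoint]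
    · congr 1
      ext x
      by_cases hx : x ∈ H <;> simp [hx]
    · rw [Finset.disjoint_left]
      intro x
      by_cases hx : x ∈ H <;> simp [hx]

lemma exists_isMatchingMap_card_eq_add [Fintype V] {g k : V → V}
    (hg : (G.induce H).spanningCoe.IsMatchingMap H.toFinite.toFinset g)
    (hk : (G.induce Hᶜ).spanningCoe.IsMatchingMap (Hᶜ).toFinite.toFinset k) :
    ∃ f, G.IsMatchingMap Finset.univ f ∧
      (movedPoints f).card = (movedPoints g).card + (movedPoints k).card := by
  have hgH : ∀ x, g x ≠ x → x ∈ H := fun x hx => (Set.Finite.mem_toFinset _).1 (hg.mem x hx)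
  have hkH : ∀ x, k x ≠ x → x ∈ Hᶜ := fun x hx => (Set.Finite.mem_toFinset _).1 (hk.mem x hx)
  have hgm : ∀ x ∈ H, g x ∈ H := fun x hx => by
    by_cases h : g x = x
    · rwa [h]
    · exact (Set.Finite.mem_toFinset _).1 (hg.apply_mem h)
  have hkm : ∀ x ∉ H, k x ∉ H := fun x hx => by
    by_cases h : k x = x
    · rwa [h]
    · exact (Set.Finite.mem_toFinset _).1 (hk.apply_mem h)
  set f : V → V := fun x => if x ∈ H then g x else k x with hf
  have hfH : ∀ x ∈ H, f x = g x := fun x hx => if_pos hx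
  have hfH' : ∀ x ∉ H, f x = k x := fun x hx => if_neg hx
  refine ⟨f, ⟨fun x => ?_, fun x hx => ?_, fun x _ => Finset.mem_univ x⟩, ?_⟩
  · by_cases hx : x ∈ H
    · rw [hfH x hx, hfH _ (hgm x hx), hg.invol]
    · rw [hfH' x hx, hfH' _ (hkm x hx), hk.invol]
  · by_cases h : x ∈ H
    · rw [hfH x h] at hx ⊢
      exact spanningCoe_induce_le G H (hg.adj x hx)
    · rw [hfH' x h] at hx ⊢
      exact spanningCoe_induce_le G Hᶜ (hk.adj x hx)
  · rw [← Finset.card_union_of_disjoint]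
    · congr 1
      ext x
      have h1 := hgH x
      have h2 := hkH x
      rw [Set.mem_compl_iff] at h2
      rw [Finset.mem_union, mem_movedPoints, mem_movedPoints, mem_movedPoints]
      by_cases hx : x ∈ H
      · rw [hfH x hx]; tauto
      · rw [hfH' x hx]; tauto
    · rw [Finset.disjoint_left]
      intro x h1 h2
      rw [mem_movedPoints] at h1 h2
      exact hkH x h2 (hgH x h1)

/-- If all edges leaving `H` start at a vertex `v` which is saturated by all maximum matchings of
the forest induced by `H`, then the matching number is additive. -/
lemma isGreatest_nullSize_add [Fintype V] {v : V} (hA : (G.induce H).spanningCoe.IsAcyclic)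
    (hB : (G.induce Hᶜ).spanningCoe.IsAcyclic) (hv : v ∈ H)
    (hcut : ∀ a ∈ H, ∀ b ∉ H, G.Adj a b → a = v)
    (hsupp : v ∉ (G.induce H).spanningCoe.suppOn H.toFinite.toFinset) :
    IsGreatest {k | ∃ f, G.IsMatchingMap Finset.univ f ∧ (movedPoints f).card = k}
      ((G.induce H).spanningCoe.nullSize H.toFinite.toFinset +
        (G.induce Hᶜ).spanningCoe.nullSize (Hᶜ).toFinite.toFinset) := by
  obtain ⟨⟨g, hg, hgc⟩, hgu⟩ := hA.isGreatest_nullSize H.toFinite.toFinset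
  obtain ⟨⟨k, hk, hkc⟩, hku⟩ := hB.isGreatest_nullSize (Hᶜ).toFinite.toFinset
  constructor
  · rw [← hgc, ← hkc]
    exact exists_isMatchingMap_card_eq_add hg hk
  · rintro n ⟨f, hf, rfl⟩
    by_cases hfH : ∀ x ∈ H, f x ∈ H
    · obtain ⟨g', k', hg', hk', -, hc⟩ := hf.card_eq_add hfH
      rw [hc]
      exact Nat.add_le_add (hgu ⟨g', hg', rfl⟩) (hku ⟨k', hk', rfl⟩)
    push Not at hfH
    obtain ⟨x, hx, hfx⟩ := hfH
    have hne : f x ≠ x := fun h => hfx (h.symm ▸ hx)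
    obtain rfl : x = v := hcut x hx _ hfx (hf.adj x hne)
    -- Every edge leaving `H` starts at `x`, so freeing `x` makes `H` invariant.
    obtain ⟨f', hf', hfv, hfw, hff, hcard⟩ := hf.exists_avoiding x
    have hfH' : ∀ y ∈ H, f' y ∈ H := by
      intro y hy
      by_contra h
      have hy' : f' y ≠ y := fun e => h (e.symm ▸ hy)
      rw [hcut y hy _ h (hf'.adj y hy')] at hy'
      exact hy' hfv
    obtain ⟨g', k', hg', hk', hgf, hc⟩ := hf'.card_eq_add hfH'
    have h1 : (movedPoints g').card ≤ _ := hgu ⟨g', hg', rfl⟩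
    have h2 : (movedPoints k').card ≤ _ := hku ⟨k', hk', rfl⟩
    have h3 : (movedPoints g').card ≠ (G.induce H).spanningCoe.nullSize H.toFinite.toFinset := fun h =>
      hsupp (hA.mem_suppOn_of_card_eq hg' h ((Set.Finite.mem_toFinset _).2 hv) ((hgf x hv).trans hfv))
    -- Both counts are even, so missing the maximum on `H` costs at least two matched vertices,
    -- which pays for the two lost by dropping the crossing edge.
    have h4 := hg'.card_movedPoints
    have h5 := hg.card_movedPoints
    omega

end Transfer

/-! ### The pendant tree and its complement in a unicyclic graph. -/

section Unicyclic

variable {V : Type*} {G : SimpleGraph V} {C : G.Subgraph} {v : V} {H : Set V}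

lemma IsUnicyclic.toSubgraph_eq (hG : G.IsUnicyclic) (hC : G.IsCycleSubgraph C) {u : V}
    {p : G.Walk u u} (hp : p.IsCycle) : p.toSubgraph = C :=
  hG.2.unique ⟨u, p, hp, rfl⟩ hC

/-- A cycle of the induced graph is a cycle of `G`, hence is `C`, and each of its vertices lies on
an edge with both ends in `H`. -/
lemma IsUnicyclic.isAcyclic_spanningCoe_induce (hG : G.IsUnicyclic) (hC : G.IsCycleSubgraph C)
    (hH : ¬ C.verts ⊆ H) : (G.induce H).spanningCoe.IsAcyclic := by
  intro u p hp
  refine hH fun x hx => ?_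
  have hle := spanningCoe_induce_le G H
  rw [← hG.toSubgraph_eq hC (hp.mapLe hle), Walk.mem_verts_toSubgraph, Walk.support_mapLe_eq_support,
    Walk.mem_support_iff_exists_mem_edges_of_not_nil hp.not_nil] at hx
  obtain ⟨e, he, hxe⟩ := hx
  have := p.edges_subset_edgeSet he
  induction e with
  | h a b =>
    rw [mem_edgeSet, spanningCoe_induce_adj_iff] at this
    rcases Sym2.mem_iff.1 hxe with rfl | rfl
    · exact this.1
    · exact this.2.1

lemma IsCycleSubgraph.not_verts_subset (hC : G.IsCycleSubgraph C) (hH : G.IsPendantTree C v H) :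
    ¬ C.verts ⊆ H := by
  obtain ⟨u, p, hp, rfl⟩ := hC
  intro hsub
  have h : ∀ x ∈ p.support, x = v := fun x hx =>
    hH.eq_of_mem x (hsub (p.mem_verts_toSubgraph.2 hx)) (p.mem_verts_toSubgraph.2 hx)
  have hadj := p.adj_snd hp.not_nil
  exact hadj.ne ((h _ p.start_mem_support).trans (h _ (p.getVert_mem_support 1)).symm)

/-- The pendant tree at `v` is attached to the rest of a unicyclic graph only at `v`. -/
lemma IsPendantTree.eq_of_adj [Finite V] (hH : G.IsPendantTree C v H) (hG : G.IsUnicyclic)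
    (hC : G.IsCycleSubgraph C) (hv : v ∈ C.verts) {a b : V} (ha : a ∈ H) (hb : b ∉ H)
    (hab : G.Adj a b) : a = v := by
  by_contra hav
  have haC : a ∉ C.verts := fun h => hav (hH.eq_of_mem a ha h)
  -- If `b` is on `C`, a detour through `H` to `v` and along `C` to `b` avoids the edge `ab`; this
  -- edge then lies on a cycle, which must be `C`, putting `a` on `C`. If `b` is off `C`, adding `b`
  -- to `H` contradicts maximality.
  by_cases hbC : b ∈ C.verts
  · have hreach : (G.deleteEdges {s(a, b)}).Reachable a b := by
      have h1 : (G.deleteEdges {s(a, b)}).Reachable a v := by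
        have := hH.connected.preconnected ⟨a, ha⟩ ⟨v, hH.mem⟩
        refine this.map ⟨Subtype.val, fun {x y} hxy => ?_⟩
        rw [deleteEdges_adj]
        refine ⟨hxy, fun he => hb ?_⟩
        rw [Set.mem_singleton_iff, Sym2.eq_iff] at he
        rcases he with ⟨-, h⟩ | ⟨h, -⟩
        · exact h ▸ y.2
        · exact h ▸ x.2
      have h2 : (G.deleteEdges {s(a, b)}).Reachable v b := by
        have hconn : C.Connected := by
          obtain ⟨u, p, -, rfl⟩ := hC
          exact p.toSubgraph_connected
        have := hconn.preconnected ⟨v, hv⟩ ⟨b, hbC⟩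
        refine this.map ⟨Subtype.val, fun {x y} hxy => ?_⟩
        rw [deleteEdges_adj]
        refine ⟨C.adj_sub hxy, fun he => haC ?_⟩
        rw [Set.mem_singleton_iff, Sym2.eq_iff] at he
        rcases he with ⟨h, -⟩ | ⟨-, h⟩
        · exact h ▸ x.2
        · exact h ▸ y.2
      exact h1.trans h2
    have hnb : ¬ G.IsBridge s(a, b) := fun h => isBridge_iff.1 h hreach
    rw [isBridge_iff_forall_cycle_notMem hab] at hnb
    push Not at hnb
    obtain ⟨u, p, hp, he⟩ := hnb
    apply haC
    rw [← hG.toSubgraph_eq hC hp, Walk.mem_verts_toSubgraph]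
    exact p.fst_mem_support_of_mem_edges he
  · have hcand : G.IsPendantCandidate C v (insert b H) := by
      refine ⟨Set.mem_insert_of_mem _ hH.mem, ?_, ?_⟩
      · rintro w (rfl | hw) hwC
        · exact absurd hwC hbC
        · exact hH.eq_of_mem w hw hwC
      · have := connected_induce_union (s := H) (t := {b}) hH.connected.preconnected
          (by simp) ha (Set.mem_singleton b) hab
        rwa [Set.union_singleton] at this
    have := hH.ncard_le _ hcand
    rw [Set.ncard_insert_of_notMem hb] at this
    omega

end Unicyclic

end SimpleGraph

/-! ### The matching number formula. -/

open SimpleGraph in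
theorem mainTheorem4 {V : Type*} [Finite V] (G : SimpleGraph V)
    (hG : G.IsUnicyclic) (hI : G.IsTypeI)
    (C : G.Subgraph) (hC : G.IsCycleSubgraph C)
    (v : V) (hv : v ∈ C.verts)
    (H : Set V) (hH : G.IsPendantTree C v H)
    (hsupp : (⟨v, hH.mem⟩ : H) ∉ (G.induce H).nullSupp) :
    (G.matchingNumber : ℚ) =
      ((G.induce H).nullCore.ncard : ℚ) + ((G.induce Hᶜ).nullCore.ncard : ℚ) +
        (((G.induce H).nForest.verts.ncard : ℚ) +
          ((G.induce Hᶜ).nForest.verts.ncard : ℚ)) / 2 := by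
  classical
  have : Fintype V := Fintype.ofFinite V
  have hA := hG.isAcyclic_spanningCoe_induce hC (hC.not_verts_subset hH)
  have hB := hG.isAcyclic_spanningCoe_induce hC (H := Hᶜ) fun h => h hv hH.mem
  have h := two_mul_matchingNumber_of_isGreatest (isGreatest_nullSize_add hA hB hH.mem
    (fun a ha b hb hab => hH.eq_of_adj hG hC hv ha hb hab)
    fun h => hsupp (mem_nullSupp_induce_iff.2 h))
  rw [nullSize_spanningCoe_induce, nullSize_spanningCoe_induce] at h
  have h' : (2 * G.matchingNumber : ℚ) = 2 * (G.induce H).nullCore.ncard +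
      (G.induce H).nForest.verts.ncard + (2 * (G.induce Hᶜ).nullCore.ncard +
      (G.induce Hᶜ).nForest.verts.ncard) := mod_cast h
  linarith
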